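/- Let $iD_\infty$ be the unital associative $\mathbb{R}$-algebra generated by two elements $a$ and $b$ subject to the relations $b^2=-1$ and $bab^{-1}=a^{-1}$ (so $b^{-1}=-b$, and $bab^{-1}$ is a two-sided inverse of $a$). For a polynomial $p\in\mathbb{R}[t]$ with $p(0)\neq 0$ and an integer $n\ge 1$, let $V(p,n)=\mathbb{R}[t]/(p^n)\oplus b\,\mathbb{R}[t]/(p^n)$ denote the representation of $iD_\infty$ in which $a$ acts on $\mathbb{R}[t]/(p^n)$ by multiplication by $t$ and $b$ carries the first summand identically onto the second; by the relations this means $$a\,(f+bg)=tf+b\,(t^{-1}g),\qquad b\,(f+bg)=-g+bf\qquad (f,g\in\mathbb{R}[t]/(p^n)).$$ A representation is called indecomposable if it is nonzero and is not the direct sum of two nonzero subrepresentations. Theorem. The finite-dimensional indecomposable real representations of $iD_\infty$ are, up to isomorphism, exactly the $V(p,n)$, where $n\ge 1$ is an integer and either 1. $p=t-r$ with $r\in\mathbb{R}\setminus\{0\}$, or 2. $p=(t-c)(t-\bar c)$ with $c\in\mathbb{C}\setminus\mathbb{R}$. That is, a real representation $V$ of $iD_\infty$ is finite-dimensional and indecomposable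 if and only if $V\cong V(p,n)$ for some such $p$ and $n$. -/

import Mathlib

open Polynomial

noncomputable section

/-- The two letters `a`, `b` generating the algebra `iD_∞`. -/
inductive IDGen : Type
  | a
  | b

/-- The defining relations of `iD_∞` in the free real algebra on `a` and `b`.
The relation `b² = -1` makes `b` invertible with `b⁻¹ = -b`, and `b a b⁻¹ = a⁻¹` says that
`b a b⁻¹ = b a (-b)` is a two-sided inverse of `a`. -/
inductive IDRel : FreeAlgebra ℝ IDGen → FreeAlgebra ℝ IDGen → Prop
  | b_sq : IDRel (FreeAlgebra.ι ℝ IDGen.b * FreeAlgebra.ι ℝ IDGen.b) (-1)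
  | conj_mul : IDRel
      ((FreeAlgebra.ι ℝ IDGen.b * FreeAlgebra.ι ℝ IDGen.a * (-FreeAlgebra.ι ℝ IDGen.b)) *
        FreeAlgebra.ι ℝ IDGen.a) 1
  | mul_conj : IDRel
      (FreeAlgebra.ι ℝ IDGen.a *
        (FreeAlgebra.ι ℝ IDGen.b * FreeAlgebra.ι ℝ IDGen.a * (-FreeAlgebra.ι ℝ IDGen.b))) 1

/-- The real algebra `iD_∞` generated by `a`, `b` with `b a b⁻¹ = a⁻¹` and `b² = -1`. -/
def IDInf : Type := RingQuot IDRel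

instance : Ring IDInf := inferInstanceAs (Ring (RingQuot IDRel))

instance : Algebra ℝ IDInf := inferInstanceAs (Algebra ℝ (RingQuot IDRel))

namespace IDInf

/-- The quotient map from the free algebra onto `iD_∞`. -/
def mk : FreeAlgebra ℝ IDGen →ₐ[ℝ] IDInf := RingQuot.mkAlgHom ℝ IDRel

theorem mk_rel {x y : FreeAlgebra ℝ IDGen} (h : IDRel x y) : mk x = mk y :=
  RingQuot.mkAlgHom_rel ℝ h

/-- The generator `a` of `iD_∞`. -/
def a : IDInf := mk (FreeAlgebra.ι ℝ IDGen.a)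

/-- The generator `b` of `iD_∞`. -/
def b : IDInf := mk (FreeAlgebra.ι ℝ IDGen.b)

theorem b_mul_b : b * b = -1 := by
  simpa [b] using mk_rel IDRel.b_sq

theorem conj_mul_a : (b * a * (-b)) * a = 1 := by
  simpa [a, b] using mk_rel IDRel.conj_mul

theorem a_mul_conj : a * (b * a * (-b)) = 1 := by
  simpa [a, b] using mk_rel IDRel.mul_conj

/-- The generator `a` as a unit of `iD_∞`. -/
def aUnit : IDInfˣ := ⟨a, b * a * (-b), a_mul_conj, conj_mul_a⟩

/-- The generator `b` as a unit of `iD_∞`. -/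
def bUnit : IDInfˣ := ⟨b, -b, by rw [mul_neg, b_mul_b, neg_neg], by rw [neg_mul, b_mul_b, neg_neg]⟩

/-- The relation `b a b⁻¹ = a⁻¹`, literally, in the group of units of `iD_∞`. -/
theorem bUnit_conj_aUnit : bUnit * aUnit * bUnit⁻¹ = aUnit⁻¹ := by
  ext
  rfl

/-- The universal property of `iD_∞`: a unit `x` and an element `y` with `y² = -1` and `y x = x⁻¹ y`
(that is, `y x y⁻¹ = x⁻¹`) in a real algebra `A` define an algebra homomorphism `iD_∞ → A`. -/
def lift {A : Type*} [Ring A] [Algebra ℝ A] (x : Aˣ) (y : A) (hy : y * y = -1)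
    (hxy : y * x = ↑x⁻¹ * y) : IDInf →ₐ[ℝ] A :=
  RingQuot.liftAlgHom ℝ
    ⟨FreeAlgebra.lift ℝ (fun g => match g with | IDGen.a => (x : A) | IDGen.b => y), by
      intro s t h
      cases h with
      | b_sq => simpa using hy
      | conj_mul => simp [hxy, mul_assoc, hy]
      | mul_conj =>
        have h1 : y * (x * y) = -↑x⁻¹ := by rw [← mul_assoc, hxy, mul_assoc, hy]; simp
        simp [mul_assoc, h1]⟩

theorem lift_a {A : Type*} [Ring A] [Algebra ℝ A] (x : Aˣ) (y : A) (hy : y * y = -1)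
    (hxy : y * x = ↑x⁻¹ * y) : lift x y hy hxy a = x :=
  (RingQuot.liftAlgHom_mkAlgHom_apply ℝ _ _ _).trans (by simp)

theorem lift_b {A : Type*} [Ring A] [Algebra ℝ A] (x : Aˣ) (y : A) (hy : y * y = -1)
    (hxy : y * x = ↑x⁻¹ * y) : lift x y hy hxy b = y :=
  (RingQuot.liftAlgHom_mkAlgHom_apply ℝ _ _ _).trans (by simp)

end IDInf

/-- A module is indecomposable if it is nonzero and is not the internal direct sum of two nonzero
submodules. -/
def IsIndecomposableModule (R V : Type*) [Ring R] [AddCommGroup V] [Module R V] : Prop :=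
  Nontrivial V ∧ ∀ W₁ W₂ : Submodule R V, IsCompl W₁ W₂ → W₁ = ⊥ ∨ W₂ = ⊥

/-- The polynomials `p = t - r` with `r ≠ 0` real, and `p = (t - c)(t - c̄)` with `c ∈ ℂ` non-real;
the latter product has real coefficients and is regarded as an element of `ℝ[t]`. -/
def IsAdmissiblePoly (p : ℝ[X]) : Prop :=
  (∃ r : ℝ, r ≠ 0 ∧ p = X - C r) ∨
  (∃ c : ℂ, c.im ≠ 0 ∧
    p.map (algebraMap ℝ ℂ) = (X - C c) * (X - C ((starRingEnd ℂ) c)))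

/-- Each non-real `c` does give an admissible polynomial, with the expected real coefficients. -/
theorem isAdmissiblePoly_of_im_ne_zero (c : ℂ) (hc : c.im ≠ 0) :
    IsAdmissiblePoly (X ^ 2 - C (2 * c.re) * X + C (Complex.normSq c)) := by
  refine Or.inr ⟨c, hc, ?_⟩
  have h1 : (C (((2 * c.re : ℝ)) : ℂ) : ℂ[X]) = C c + C ((starRingEnd ℂ) c) := by
    rw [← C_add, Complex.add_conj]
  have h2 : (C ((Complex.normSq c : ℝ) : ℂ) : ℂ[X]) = C c * C ((starRingEnd ℂ) c) := by
    rw [← C_mul, Complex.mul_conj]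
  simp only [Polynomial.map_add, Polynomial.map_sub, Polynomial.map_mul, Polynomial.map_pow,
    map_X, map_C, Complex.coe_algebraMap]
  rw [h1, h2]
  ring

theorem IsAdmissiblePoly.eval_zero_ne_zero {p : ℝ[X]} (hp : IsAdmissiblePoly p) :
    p.eval 0 ≠ 0 := by
  rcases hp with ⟨r, hr, rfl⟩ | ⟨c, hc, h⟩
  · simpa using hr
  · intro h0
    have h1 : (p.map (algebraMap ℝ ℂ)).eval 0 = 0 := by
      have := Polynomial.eval_map_algebraMap (B := ℂ) p 0
      rw [this, Polynomial.aeval_def, ← Polynomial.coeff_zero_eq_eval_zero] at *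
      simp [h0, Polynomial.eval₂_at_zero]
    rw [h] at h1
    have : c = 0 := by simpa using h1
    exact hc (by simp [this])

/-- If `p(0) ≠ 0` then `t` is invertible in `ℝ[t]/(pⁿ)`. -/
theorem isUnit_root_pow (p : ℝ[X]) (hp : p.eval 0 ≠ 0) (n : ℕ) :
    IsUnit (AdjoinRoot.root (p ^ n)) := by
  have h : IsCoprime (X : ℝ[X]) (p ^ n) := by
    refine IsCoprime.pow_right ?_
    refine (Polynomial.irreducible_X.coprime_iff_not_dvd).2 ?_
    rw [Polynomial.X_dvd_iff, Polynomial.coeff_zero_eq_eval_zero]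
    exact hp
  obtain ⟨u, v, huv⟩ := h
  refine IsUnit.of_mul_eq_one (AdjoinRoot.mk (p ^ n) u) ?_
  have := congrArg (AdjoinRoot.mk (p ^ n)) huv
  simpa [mul_comm] using this

/-- The class of `t`, as a unit of `ℝ[t]/(pⁿ)`. -/
def tUnit (p : ℝ[X]) (hp : IsAdmissiblePoly p) (n : ℕ) : (AdjoinRoot (p ^ n))ˣ :=
  (isUnit_root_pow p hp.eval_zero_ne_zero n).unit

/-- The space `ℝ[t]/(pⁿ) ⊕ b ℝ[t]/(pⁿ)`; the pair `(f, g)` stands for `f + b g`. -/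
def IDModel (p : ℝ[X]) (_hp : IsAdmissiblePoly p) (n : ℕ) : Type :=
  AdjoinRoot (p ^ n) × AdjoinRoot (p ^ n)

namespace IDModel

variable (p : ℝ[X]) (hp : IsAdmissiblePoly p) (n : ℕ)

instance : AddCommGroup (IDModel p hp n) :=
  inferInstanceAs (AddCommGroup (AdjoinRoot (p ^ n) × AdjoinRoot (p ^ n)))

instance : Module ℝ (IDModel p hp n) :=
  inferInstanceAs (Module ℝ (AdjoinRoot (p ^ n) × AdjoinRoot (p ^ n)))

/-- For a unit `u` of `ℝ[t]/(pⁿ)`, the operator `f + b g ↦ u f + b (u⁻¹ g)`. -/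
def scale (u : (AdjoinRoot (p ^ n))ˣ) : Module.End ℝ (IDModel p hp n) :=
  LinearMap.prodMap (LinearMap.mulLeft ℝ (u : AdjoinRoot (p ^ n)))
    (LinearMap.mulLeft ℝ ((u⁻¹ : (AdjoinRoot (p ^ n))ˣ) : AdjoinRoot (p ^ n)))

theorem scale_mul_inv (u : (AdjoinRoot (p ^ n))ˣ) :
    scale p hp n u * scale p hp n u⁻¹ = 1 :=
  LinearMap.ext fun x => Prod.ext (u.mul_inv_cancel_left x.1) (u.inv_mul_cancel_left x.2)

/-- The action of `a`: it multiplies the first summand by `t`; on the second summand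
`a (b g) = b (a⁻¹ g)`, as `a b = b a⁻¹` in `iD_∞`, so that `f + b g ↦ t f + b (t⁻¹ g)`. -/
def actA : (Module.End ℝ (IDModel p hp n))ˣ where
  val := scale p hp n (tUnit p hp n)
  inv := scale p hp n (tUnit p hp n)⁻¹
  val_inv := by
    simpa using scale_mul_inv p hp n (tUnit p hp n)
  inv_val := by
    simpa using scale_mul_inv p hp n (tUnit p hp n)⁻¹

/-- The action of `b`: `f + b g ↦ -g + b f`, since `b² = -1`. -/
def actB : Module.End ℝ (IDModel p hp n) :=
  LinearMap.prod (-LinearMap.snd ℝ (AdjoinRoot (p ^ n)) (AdjoinRoot (p ^ n)))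
    (LinearMap.fst ℝ (AdjoinRoot (p ^ n)) (AdjoinRoot (p ^ n)))

/-- The representation of `iD_∞` on `ℝ[t]/(pⁿ) ⊕ b ℝ[t]/(pⁿ)`. -/
def rep : IDInf →ₐ[ℝ] Module.End ℝ (IDModel p hp n) :=
  IDInf.lift (actA p hp n) (actB p hp n)
    (LinearMap.ext fun _ => rfl)
    (LinearMap.ext fun x => Prod.ext (mul_neg _ x.2).symm (by
      change _ = (((tUnit p hp n)⁻¹)⁻¹ : (AdjoinRoot (p ^ n))ˣ) * x.1
      rw [inv_inv]
      rfl))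

instance : Module IDInf (IDModel p hp n) :=
  Module.compHom (IDModel p hp n) (rep p hp n).toRingHom

instance : IsScalarTower ℝ IDInf (IDModel p hp n) where
  smul_assoc r x v := by
    change rep p hp n (r • x) v = r • rep p hp n x v
    rw [map_smul]
    rfl

/-- The element `f + b g` of the representation. -/
def mk (f g : AdjoinRoot (p ^ n)) : IDModel p hp n := (f, g)

theorem a_smul_mk (f g : AdjoinRoot (p ^ n)) :
    IDInf.a • mk p hp n f g =
      mk p hp n (AdjoinRoot.root (p ^ n) * f) (((tUnit p hp n)⁻¹ : (AdjoinRoot (p ^ n))ˣ) * g) := by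
  change rep p hp n IDInf.a _ = _
  rw [rep, IDInf.lift_a]
  rfl

theorem b_smul_mk (f g : AdjoinRoot (p ^ n)) :
    IDInf.b • mk p hp n f g = mk p hp n (-g) f := by
  change rep p hp n IDInf.b _ = _
  rw [rep, IDInf.lift_b]
  rfl

end IDModel

end

/-! Both directions rest on `IDModel.socleGen_mem`: every nonzero subrepresentation of V(p, n)
contains the vector pⁿ⁻¹ of the first summand. Two nonzero subrepresentations therefore always meet,
and V(p, n) is indecomposable. To prove it, write p as the minimal polynomial of some c ≠ 0 and note
that a acts by t on one summand and by t⁻¹ on the other. If |c| ≠ 1, then p(c⁻¹) ≠ 0, so p(a⁻¹) is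
invertible on the first summand and nilpotent on the second, which separates them. If |c| = 1, then
c⁻¹ is the conjugate of c, and the positivity of |α(c)|² + |β(c)|² replaces the separation.

Conversely, on a nonzero finite-dimensional V the invertible a has a nonzero complex eigenvalue c;
let p be its minimal polynomial. Choose v with p(a)ⁿ v = 0 and p(a)ⁿ⁻¹ v ∉ p(a)ⁿ V, and a functional
λ that kills p(a)ⁿ V but not p(a)ⁿ⁻¹ v. The largest subrepresentation K inside ker λ pulls back
along V(p, n) → V to a subrepresentation missing the socle vector, hence to zero. So the map is
injective and its image meets K trivially. As K has codimension at most 2 deg pⁿ = dim V(p, n), it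
is a complement of the image (`exists_isCompl_range_toRep`). If V is indecomposable, K = 0. -/

noncomputable section

/-! ### Calculus in `IDInf`, and reduction of linearity and stability to the generators -/

namespace IDInf

/-- The inverse `a⁻¹` of the generator `a`. -/
def aInv : IDInf := ↑(aUnit⁻¹ : IDInfˣ)

theorem a_mul_aInv : a * aInv = 1 := aUnit.mul_inv

theorem aInv_mul_a : aInv * a = 1 := aUnit.inv_mul

theorem b_mul_a : b * a = aInv * b := by
  change b * a = b * a * (-b) * b
  rw [mul_assoc (b * a), neg_mul, b_mul_b, neg_neg, mul_one]

theorem b_mul_aInv : b * aInv = a * b := by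
  have h : aInv * b = b * a := b_mul_a.symm
  calc b * aInv = a * (aInv * b) * aInv := by rw [← mul_assoc, a_mul_aInv, one_mul]
    _ = a * b := by rw [h, mul_assoc, mul_assoc, a_mul_aInv, mul_one]

theorem adjoin_a_b : Algebra.adjoin ℝ ({a, b} : Set IDInf) = ⊤ := by
  have hs : Function.Surjective mk := RingQuot.mkAlgHom_surjective ℝ IDRel
  rw [← top_le_iff]
  rintro x -
  obtain ⟨y, rfl⟩ := hs x
  induction y using FreeAlgebra.induction with
  | grade0 r => rw [AlgHom.commutes]; exact Subalgebra.algebraMap_mem _ r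
  | grade1 g =>
    cases g
    · exact Algebra.subset_adjoin (Or.inl rfl)
    · exact Algebra.subset_adjoin (Or.inr rfl)
  | mul x y hx hy => rw [map_mul]; exact mul_mem hx hy
  | add x y hx hy => rw [map_add]; exact add_mem hx hy

theorem induction_on {P : IDInf → Prop} (hr : ∀ r : ℝ, P (algebraMap ℝ IDInf r)) (ha : P a)
    (hb : P b) (hadd : ∀ x y, P x → P y → P (x + y)) (hmul : ∀ x y, P x → P y → P (x * y))
    (x : IDInf) : P x := by
  have hx : x ∈ Algebra.adjoin ℝ ({a, b} : Set IDInf) := adjoin_a_b ▸ Algebra.mem_top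
  induction hx using Algebra.adjoin_induction with
  | mem x hx => rcases hx with rfl | rfl <;> assumption
  | algebraMap r => exact hr r
  | add x y _ _ hx hy => exact hadd x y hx hy
  | mul x y _ _ hx hy => exact hmul x y hx hy

section Module

variable {V W : Type*} [AddCommGroup V] [Module ℝ V] [Module IDInf V] [IsScalarTower ℝ IDInf V]
  [AddCommGroup W] [Module ℝ W] [Module IDInf W] [IsScalarTower ℝ IDInf W]

/-- A real linear map commuting with `a` and `b` is a homomorphism of representations. -/
def linearMapOfCommute (φ : V →ₗ[ℝ] W) (ha : ∀ v, φ (a • v) = a • φ v)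
    (hb : ∀ v, φ (b • v) = b • φ v) : V →ₗ[IDInf] W where
  toFun := φ
  map_add' := map_add φ
  map_smul' x := by
    dsimp only [RingHom.id_apply]
    induction x using induction_on with
    | hr r => intro v; simp only [algebraMap_smul, map_smul]
    | ha => exact ha
    | hb => exact hb
    | hadd x y hx hy => intro v; rw [add_smul, map_add, hx, hy, add_smul]
    | hmul x y hx hy => intro v; rw [mul_smul, hx, hy, mul_smul]

/-- A real subspace stable under `a` and `b` is a subrepresentation. -/
def submoduleOfStable (K : Submodule ℝ V) (ha : ∀ v ∈ K, a • v ∈ K) (hb : ∀ v ∈ K, b • v ∈ K) :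
    Submodule IDInf V where
  carrier := K
  add_mem' := K.add_mem
  zero_mem' := K.zero_mem
  smul_mem' x := by
    induction x using induction_on with
    | hr r => intro v hv; rw [algebraMap_smul]; exact K.smul_mem r hv
    | ha => exact ha _
    | hb => exact hb _
    | hadd x y hx hy => intro v hv; rw [add_smul]; exact K.add_mem (hx hv) (hy hv)
    | hmul x y hx hy => intro v hv; rw [mul_smul]; exact hx (hy hv)

end Module

end IDInf

/-! ### Admissible polynomials as minimal polynomials -/

/-- The admissible polynomials are the real minimal polynomials of nonzero complex numbers. -/
theorem isAdmissiblePoly_iff_minpoly {p : ℝ[X]} :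
    IsAdmissiblePoly p ↔ ∃ c : ℂ, c ≠ 0 ∧ p = minpoly ℝ c := by
  have key (c : ℂ) (hc : c.im ≠ 0) :
      X ^ 2 - C (2 * c.re) * X + C (Complex.normSq c) = minpoly ℝ c := by
    have hdeg : (X ^ 2 - C (2 * c.re) * X + C (Complex.normSq c)).degree = 2 := by
      compute_degree!
    have hmon : (X ^ 2 - C (2 * c.re) * X + C (Complex.normSq c)).Monic := by
      monicity!
    have hroot : aeval c (X ^ 2 - C (2 * c.re) * X + C (Complex.normSq c)) = 0 := by
      apply Complex.ext <;> simp [Complex.normSq_apply, pow_two] <;> ring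
    refine minpoly.unique _ _ hmon hroot fun q hq hq0 => ?_
    refine degree_le_of_dvd ?_ hq.ne_zero
    rw [Complex.normSq_eq_norm_sq]
    exact q.quadratic_dvd_of_aeval_eq_zero_im_ne_zero hq0 hc
  have hlin (r : ℝ) : minpoly ℝ (r : ℂ) = X - C r := minpoly.eq_X_sub_C ℂ r
  constructor
  · rintro (⟨r, hr, rfl⟩ | ⟨c, hc, h⟩)
    · exact ⟨r, by exact_mod_cast hr, (hlin r).symm⟩
    · refine ⟨c, fun h0 => hc (by simp [h0]), ?_⟩
      rw [← key c hc]
      apply Polynomial.map_injective (algebraMap ℝ ℂ) (algebraMap ℝ ℂ).injective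
      rcases isAdmissiblePoly_of_im_ne_zero c hc with ⟨r, _, h'⟩ | ⟨c', _, h'⟩
      · have := congrArg natDegree h'
        rw [natDegree_X_sub_C] at this
        have h2 : (X ^ 2 - C (2 * c.re) * X + C (Complex.normSq c)).natDegree = 2 := by
          compute_degree!
        omega
      · rw [h]
        have h1 : (C (((2 * c.re : ℝ)) : ℂ) : ℂ[X]) = C c + C ((starRingEnd ℂ) c) := by
          rw [← C_add, Complex.add_conj]
        have h2 : (C ((Complex.normSq c : ℝ) : ℂ) : ℂ[X]) = C c * C ((starRingEnd ℂ) c) := by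
          rw [← C_mul, Complex.mul_conj]
        simp only [Polynomial.map_add, Polynomial.map_sub, Polynomial.map_mul, Polynomial.map_pow,
          map_X, map_C, Complex.coe_algebraMap]
        rw [h1, h2]
        ring
  · rintro ⟨c, hc, rfl⟩
    by_cases him : c.im = 0
    · have hcr : ((c.re : ℝ) : ℂ) = c := Complex.ext (by simp) (by simp [him])
      refine Or.inl ⟨c.re, fun h => hc (by rw [← hcr, h]; simp), ?_⟩
      rw [← hlin, hcr]
    · rw [← key c him]
      exact isAdmissiblePoly_of_im_ne_zero c him

theorem IsAdmissiblePoly.monic {p : ℝ[X]} (hp : IsAdmissiblePoly p) : p.Monic := by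
  obtain ⟨c, -, rfl⟩ := isAdmissiblePoly_iff_minpoly.1 hp
  exact minpoly.monic (Algebra.IsIntegral.isIntegral c)

theorem IsAdmissiblePoly.irreducible {p : ℝ[X]} (hp : IsAdmissiblePoly p) : Irreducible p := by
  obtain ⟨c, -, rfl⟩ := isAdmissiblePoly_iff_minpoly.1 hp
  exact minpoly.irreducible (Algebra.IsIntegral.isIntegral c)

/-- If an operator `T` is nilpotent at `x ≠ 0`, some iterate of `x` is a nonzero element of its
kernel. -/
theorem exists_pow_smul_ne_zero {A M : Type*} [Monoid A] [AddMonoid M] [DistribMulAction A M]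
    {T : A} {x : M} (hx : x ≠ 0) {n : ℕ} (hn : T ^ n • x = 0) :
    ∃ k, T ^ k • x ≠ 0 ∧ T • T ^ k • x = 0 := by
  classical
  have hex : ∃ n, T ^ n • x = 0 := ⟨n, hn⟩
  obtain ⟨k, hk⟩ : ∃ k, Nat.find hex = k + 1 := by
    -- The least annihilating exponent is positive because `T ^ 0` fixes `x ≠ 0`; its predecessor is
    -- the required `k`.
    refine Nat.exists_eq_succ_of_ne_zero fun h0 => hx ?_
    simpa [h0] using Nat.find_spec hex
  refine ⟨k, Nat.find_min hex (by omega), ?_⟩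
  rw [← mul_smul, ← pow_succ', ← hk]
  exact Nat.find_spec hex

/-! ### The local ring ℝ[t]/(pⁿ⁺¹) and the effect of t ↦ t⁻¹ on p -/

section PrimaryQuotient

variable {c : ℂ} {n : ℕ}

/-- Evaluation at `c` on `ℝ[t]/(pⁿ)`, where `p` is the minimal polynomial of `c`. -/
def evalAt (c : ℂ) (n : ℕ) : AdjoinRoot (minpoly ℝ c ^ (n + 1)) →ₐ[ℝ] ℂ :=
  AdjoinRoot.liftAlgHom _ (Algebra.ofId ℝ ℂ) c (by
    -- The exponent must be positive here: for exponent 0 the quotient is the zero ring.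
    change aeval c _ = 0
    simp)

theorem evalAt_mk (f : ℝ[X]) : evalAt c n (AdjoinRoot.mk _ f) = aeval c f :=
  rfl

/-- A representative not vanishing at `c` is coprime to the irreducible minimal polynomial, hence to
its powers. -/
theorem isUnit_of_evalAt_ne_zero {x : AdjoinRoot (minpoly ℝ c ^ (n + 1))}
    (hx : evalAt c n x ≠ 0) : IsUnit x := by
  obtain ⟨f, rfl⟩ := AdjoinRoot.mk_surjective x
  rw [evalAt_mk, Ne, ← minpoly.dvd_iff] at hx
  have hcop : IsCoprime f (minpoly ℝ c ^ (n + 1)) :=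
    ((minpoly.irreducible (Algebra.IsIntegral.isIntegral c)).coprime_iff_not_dvd.2 hx).symm.pow_right
  obtain ⟨u, v, huv⟩ := hcop
  refine IsUnit.of_mul_eq_one (AdjoinRoot.mk _ u) ?_
  have := congrArg (AdjoinRoot.mk (minpoly ℝ c ^ (n + 1))) huv
  rw [map_add, map_mul, map_mul, AdjoinRoot.mk_self, mul_zero, add_zero, map_one] at this
  rw [mul_comm, this]

theorem exists_eq_pow_mul {p : ℝ[X]} (hp : p ≠ 0) {x : AdjoinRoot (p ^ (n + 1))}
    (hx : AdjoinRoot.mk _ p * x = 0) : ∃ y, x = AdjoinRoot.mk _ p ^ n * y := by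
  obtain ⟨f, rfl⟩ := AdjoinRoot.mk_surjective x
  rw [← map_mul, AdjoinRoot.mk_eq_zero, pow_succ', mul_dvd_mul_iff_left hp] at hx
  obtain ⟨g, rfl⟩ := hx
  exact ⟨AdjoinRoot.mk _ g, by rw [map_mul, map_pow]⟩

/-- On the unit circle c⁻¹ is the conjugate of `c`, hence again a root of p, so p divides its
reverse p*. Then p(u) = p*(u⁻¹) u^(deg p) is a multiple of p(u⁻¹). Used for `u` and for `u⁻¹`, this
shows that p(t) and p(t⁻¹) divide each other. -/
theorem aeval_aeval_dvd_of_norm_eq_one (hc : ‖c‖ = 1) {S : Type*} [CommRing S] [Algebra ℝ S]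
    (u : Sˣ) : aeval (↑u⁻¹ : S) (minpoly ℝ c) ∣ aeval (u : S) (minpoly ℝ c) := by
  have hc0 : c ≠ 0 := by rintro rfl; simp at hc
  have hconj : (starRingEnd ℂ) c = c⁻¹ := by
    rw [Complex.inv_def, Complex.normSq_eq_norm_sq, hc]; simp
  have hdvd : minpoly ℝ c ∣ (minpoly ℝ c).reverse := by
    have h := eval₂_reverse_mul_pow (algebraMap ℝ ℂ) (Units.mk0 c hc0)⁻¹ (minpoly ℝ c)
    rw [minpoly.dvd_iff]
    have h2 : aeval c⁻¹ (minpoly ℝ c) = 0 := by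
      rw [← hconj, aeval_conj, minpoly.aeval, map_zero]
    change aeval c _ * _ = aeval c⁻¹ _ at h
    rw [h2] at h
    exact (mul_eq_zero.1 h).resolve_right (pow_ne_zero _ (inv_ne_zero hc0))
  obtain ⟨h, hh⟩ := hdvd
  have := eval₂_reverse_mul_pow (algebraMap ℝ S) u (minpoly ℝ c)
  change aeval _ _ * _ = aeval _ _ at this
  rw [invOf_units, hh, map_mul] at this
  rw [← this, mul_assoc]
  exact dvd_mul_right _ _

/-- If c⁻¹ were a root, it would be a Galois conjugate of `c` over ℝ. The only automorphisms are the
identity and conjugation, both preserving the norm, whereas ‖c⁻¹‖ ≠ ‖c‖. -/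
theorem aeval_inv_minpoly_ne_zero (hc0 : c ≠ 0) (hc : ‖c‖ ≠ 1) :
    aeval c⁻¹ (minpoly ℝ c) ≠ 0 := by
  intro h
  have hn : ‖c‖ ≠ ‖c⁻¹‖ := by
    rw [norm_inv]
    intro h
    have h0 : 0 < ‖c‖ := norm_pos_iff.2 hc0
    have : ‖c‖ * ‖c‖ = 1 := by nth_rw 2 [h]; exact mul_inv_cancel₀ h0.ne'
    exact hc (by nlinarith)
  have hconj : IsConjRoot ℝ c c⁻¹ := by
    rw [isConjRoot_iff_aeval_eq_zero (Algebra.IsIntegral.isIntegral c)]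
    exact h
  have : Normal ℝ ℂ := normal_iff.2 fun z =>
    ⟨Algebra.IsIntegral.isIntegral z, IsAlgClosed.splits _⟩
  obtain ⟨σ, hσ⟩ := (isConjRoot_iff_exists_algEquiv (K := ℝ) (L := ℂ)).1 hconj
  rcases Complex.real_algHom_eq_id_or_conj σ.toAlgHom with h1 | h1
  · exact hn ((congrArg norm hσ).symm.trans (congrArg norm (AlgHom.congr_fun h1 c⁻¹)))
  · exact hn ((congrArg norm hσ).symm.trans
      ((congrArg norm (AlgHom.congr_fun h1 c⁻¹)).trans (Complex.norm_conj _)))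

end PrimaryQuotient

/-! ### Action of polynomials in a and a⁻¹ on V(p, n) -/

namespace IDModel

section Action

variable {p : ℝ[X]} (hp : IsAdmissiblePoly p) (n : ℕ)

theorem exists_eq_mk (x : IDModel p hp n) : ∃ f g, x = mk p hp n f g := ⟨x.1, x.2, rfl⟩

theorem mk_eq_mk_iff {f g f' g' : AdjoinRoot (p ^ n)} :
    mk p hp n f g = mk p hp n f' g' ↔ f = f' ∧ g = g' := Prod.mk_inj

theorem mk_eq_zero_iff {f g : AdjoinRoot (p ^ n)} : mk p hp n f g = 0 ↔ f = 0 ∧ g = 0 :=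
  Prod.mk_inj

theorem mk_add_mk (f g f' g' : AdjoinRoot (p ^ n)) :
    mk p hp n f g + mk p hp n f' g' = mk p hp n (f + f') (g + g') := rfl

theorem mk_sub_mk (f g f' g' : AdjoinRoot (p ^ n)) :
    mk p hp n f g - mk p hp n f' g' = mk p hp n (f - f') (g - g') := rfl

theorem real_smul_mk (r : ℝ) (f g : AdjoinRoot (p ^ n)) :
    r • mk p hp n f g = mk p hp n (r • f) (r • g) := rfl

/-- The inverse of the class of `t`. -/
def tInv : AdjoinRoot (p ^ n) := ((tUnit p hp n)⁻¹ : (AdjoinRoot (p ^ n))ˣ)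

theorem root_mul_tInv : AdjoinRoot.root (p ^ n) * tInv hp n = 1 := (tUnit p hp n).mul_inv

theorem aInv_smul_mk (f g : AdjoinRoot (p ^ n)) :
    IDInf.aInv • mk p hp n f g = mk p hp n (tInv hp n * f) (AdjoinRoot.root (p ^ n) * g) := by
  have h : mk p hp n f g =
      IDInf.a • mk p hp n (tInv hp n * f) (AdjoinRoot.root (p ^ n) * g) := by
    rw [a_smul_mk, mk_eq_mk_iff, ← mul_assoc, root_mul_tInv, one_mul, ← mul_assoc]
    refine ⟨rfl, ?_⟩
    change g = tInv hp n * _ * g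
    rw [mul_comm (tInv hp n), root_mul_tInv, one_mul]
  rw [h, ← mul_smul, IDInf.aInv_mul_a, one_smul]

theorem aeval_smul_mk {x : IDInf} {u w : AdjoinRoot (p ^ n)}
    (hx : ∀ f g, x • mk p hp n f g = mk p hp n (u * f) (w * g)) (h : ℝ[X])
    (f g : AdjoinRoot (p ^ n)) :
    aeval x h • mk p hp n f g = mk p hp n (aeval u h * f) (aeval w h * g) := by
  induction h using Polynomial.induction_on generalizing f g with
  | C r =>
    simp only [aeval_C, algebraMap_smul, real_smul_mk, Algebra.smul_def]
  | add h₁ h₂ ih₁ ih₂ => simp only [map_add, add_smul, ih₁, ih₂, mk_add_mk, add_mul]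
  | monomial k r ih =>
    rw [pow_succ, ← mul_assoc, map_mul, mul_smul, aeval_X, hx, ih]
    simp only [map_mul, aeval_X, mul_assoc]

theorem aeval_a_smul_mk (h : ℝ[X]) (f g : AdjoinRoot (p ^ n)) :
    aeval IDInf.a h • mk p hp n f g =
      mk p hp n (AdjoinRoot.mk _ h * f) (aeval (tInv hp n) h * g) := by
  rw [aeval_smul_mk hp n (a_smul_mk p hp n), AdjoinRoot.aeval_eq]
  rfl

theorem aeval_aInv_smul_mk (h : ℝ[X]) (f g : AdjoinRoot (p ^ n)) :
    aeval IDInf.aInv h • mk p hp n f g =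
      mk p hp n (aeval (tInv hp n) h * f) (AdjoinRoot.mk _ h * g) := by
  rw [aeval_smul_mk hp n (aInv_smul_mk hp n), AdjoinRoot.aeval_eq]

end Action

/-! ### The socle vector and indecomposability of V(p, n) -/

section Socle

variable {p : ℝ[X]} (hp : IsAdmissiblePoly p) (n : ℕ)

/-- A nonzero element of `V(p, n + 1)` lying in every nonzero subrepresentation. -/
def socleGen : IDModel p hp (n + 1) := mk p hp (n + 1) (AdjoinRoot.mk _ (p ^ n)) 0

theorem socleGen_ne_zero : socleGen hp n ≠ 0 := by
  intro h
  have h1 := ((mk_eq_zero_iff hp (n + 1)).1 h).1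
  rw [AdjoinRoot.mk_eq_zero, pow_dvd_pow_iff hp.irreducible.ne_zero hp.irreducible.not_isUnit] at h1
  omega

theorem socleGen_mem_of_isUnit_mul {W : Submodule IDInf (IDModel p hp (n + 1))}
    {u : AdjoinRoot (p ^ (n + 1))} (hu : IsUnit u)
    (h : mk p hp (n + 1) (AdjoinRoot.mk _ p ^ n * u) 0 ∈ W) : socleGen hp n ∈ W := by
  obtain ⟨v, hv⟩ := hu.exists_right_inv
  obtain ⟨f, rfl⟩ := AdjoinRoot.mk_surjective v
  have := W.smul_mem (aeval IDInf.a f) h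
  rwa [aeval_a_smul_mk, mul_zero, mul_left_comm, mul_comm (AdjoinRoot.mk _ f), hv, mul_one,
    ← map_pow] at this

end Socle

section SocleMem

variable {c : ℂ} (hp : IsAdmissiblePoly (minpoly ℝ c)) (n : ℕ)

theorem evalAt_tInv : evalAt c n (tInv hp (n + 1)) = c⁻¹ := by
  have h := congrArg (evalAt c n) (root_mul_tInv hp (n + 1))
  rw [map_mul, map_one, ← AdjoinRoot.mk_X, evalAt_mk, aeval_X] at h
  exact eq_inv_of_mul_eq_one_right h

theorem evalAt_aeval_tInv (f : ℝ[X]) :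
    evalAt c n (aeval (tInv hp (n + 1)) f) = aeval c⁻¹ f := by
  rw [← aeval_algHom_apply, evalAt_tInv]

/-- When `|c| = 1`, the socle is a one-dimensional space over `ℝ[b]` or over the quaternions, and
the norm form provides the inverses. -/
theorem socleGen_mem_of_norm_eq_one (hc : ‖c‖ = 1)
    {W : Submodule IDInf (IDModel (minpoly ℝ c) hp (n + 1))} (hW : W ≠ ⊥) :
    socleGen hp n ∈ W := by
  set π : AdjoinRoot (minpoly ℝ c ^ (n + 1)) := AdjoinRoot.mk _ (minpoly ℝ c) with hπ
  have hp0 : minpoly ℝ c ≠ 0 := hp.irreducible.ne_zero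
  have hdvd : aeval (tInv hp (n + 1)) (minpoly ℝ c) ∣ π := by
    rw [hπ, ← AdjoinRoot.aeval_eq]
    exact aeval_aeval_dvd_of_norm_eq_one hc (tUnit _ hp (n + 1))
  have hdvd' : π ∣ aeval (tInv hp (n + 1)) (minpoly ℝ c) := by
    rw [hπ, ← AdjoinRoot.aeval_eq]
    have := aeval_aeval_dvd_of_norm_eq_one hc (tUnit _ hp (n + 1))⁻¹
    rwa [inv_inv] at this
  have hπn : π ^ (n + 1) = 0 := by rw [hπ, ← map_pow, AdjoinRoot.mk_self]
  obtain ⟨x, hx, hx0⟩ := W.ne_bot_iff.1 hW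
  -- On the second summand p(a) acts as p(t⁻¹), a multiple of π, so it is nilpotent there too.
  have hnil : aeval IDInf.a (minpoly ℝ c) ^ (n + 1) • x = 0 := by
    obtain ⟨f, g, rfl⟩ := exists_eq_mk hp _ x
    obtain ⟨z, hz⟩ := hdvd'
    rw [← map_pow, aeval_a_smul_mk, map_pow, map_pow, hz, mul_pow, ← hπ, hπn]
    simp only [zero_mul]
    rfl
  obtain ⟨k, hk0, hk⟩ := exists_pow_smul_ne_zero hx0 hnil
  have hkW := W.smul_mem (aeval IDInf.a (minpoly ℝ c) ^ k) hx
  obtain ⟨f, g, hfg⟩ := exists_eq_mk hp _ (aeval IDInf.a (minpoly ℝ c) ^ k • x)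
  rw [hfg] at hk0 hk hkW
  rw [aeval_a_smul_mk, mk_eq_zero_iff] at hk
  obtain ⟨α, hα⟩ := exists_eq_pow_mul hp0 hk.1
  obtain ⟨β, hβ⟩ : ∃ y, g = AdjoinRoot.mk _ (minpoly ℝ c) ^ n * y := by
    obtain ⟨z, hz⟩ := hdvd
    refine exists_eq_pow_mul hp0 ?_
    rw [← hπ, hz, mul_right_comm, hk.2, zero_mul]
  rw [← hπ] at hα hβ
  obtain ⟨α, rfl⟩ := AdjoinRoot.mk_surjective α
  obtain ⟨β, rfl⟩ := AdjoinRoot.mk_surjective β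
  subst hα hβ
  -- Applying α(a⁻¹) − b β(a) to πⁿα + b πⁿβ cancels the second component and leaves πⁿ(α(t⁻¹)α +
  -- β(t⁻¹)β). Evaluated at `c`, the bracket is |α(c)|² + |β(c)|².
  have hnorm := W.sub_mem (W.smul_mem (aeval IDInf.aInv α) hkW)
    (W.smul_mem IDInf.b (W.smul_mem (aeval IDInf.a β) hkW))
  rw [aeval_a_smul_mk, aeval_aInv_smul_mk, b_smul_mk] at hnorm
  refine socleGen_mem_of_isUnit_mul hp n
    (u := aeval (tInv hp (n + 1)) α * AdjoinRoot.mk _ α +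
      aeval (tInv hp (n + 1)) β * AdjoinRoot.mk _ β) ?_ ?_
  · apply isUnit_of_evalAt_ne_zero
    have hconj : c⁻¹ = (starRingEnd ℂ) c := by
      rw [Complex.inv_def, Complex.normSq_eq_norm_sq, hc]; simp
    rw [map_add, map_mul, map_mul, evalAt_aeval_tInv, evalAt_aeval_tInv, evalAt_mk, evalAt_mk,
      hconj, aeval_conj, aeval_conj, ← Complex.normSq_eq_conj_mul_self,
      ← Complex.normSq_eq_conj_mul_self]
    intro h
    have h' : Complex.normSq (aeval c α) + Complex.normSq (aeval c β) = 0 := by exact_mod_cast h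
    have h1 := Complex.normSq_nonneg (aeval c α)
    have h2 := Complex.normSq_nonneg (aeval c β)
    -- If both values vanish, p divides α and β, so the chosen nonzero vector would be zero.
    have hzero (γ : ℝ[X]) (hγ : Complex.normSq (aeval c γ) = 0) :
        π ^ n * AdjoinRoot.mk _ γ = 0 := by
      rw [Complex.normSq_eq_zero, ← minpoly.dvd_iff] at hγ
      obtain ⟨δ, rfl⟩ := hγ
      rw [map_mul, ← hπ, ← mul_assoc, ← pow_succ, hπn, zero_mul]
    refine hk0 ((mk_eq_zero_iff hp _).2 ⟨hzero α (by linarith), hzero β (by linarith)⟩)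
  · rw [mk_sub_mk] at hnorm
    refine Eq.mp (congrArg (· ∈ W) ((mk_eq_mk_iff hp _).2 ⟨?_, ?_⟩)) hnorm <;>
      (try rw [← hπ]) <;> ring

/-- When `|c| ≠ 1`, the summand `b ℝ[t]/(pⁿ)` is killed by a power of `p(a⁻¹)`, which acts
invertibly on the first summand. -/
theorem socleGen_mem_of_norm_ne_one (hc0 : c ≠ 0) (hc : ‖c‖ ≠ 1)
    {W : Submodule IDInf (IDModel (minpoly ℝ c) hp (n + 1))} (hW : W ≠ ⊥) :
    socleGen hp n ∈ W := by
  set π : AdjoinRoot (minpoly ℝ c ^ (n + 1)) := AdjoinRoot.mk _ (minpoly ℝ c) with hπ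
  have hπn : π ^ (n + 1) = 0 := by rw [hπ, ← map_pow, AdjoinRoot.mk_self]
  have hunit : IsUnit (aeval (tInv hp (n + 1)) (minpoly ℝ c)) := by
    apply isUnit_of_evalAt_ne_zero
    rw [evalAt_aeval_tInv]
    exact aeval_inv_minpoly_ne_zero hc0 hc
  obtain ⟨f, g, hfg, hf⟩ : ∃ f g, mk _ hp (n + 1) f g ∈ W ∧ f ≠ 0 := by
    obtain ⟨x, hx, hx0⟩ := W.ne_bot_iff.1 hW
    obtain ⟨f, g, rfl⟩ := exists_eq_mk hp _ x
    -- If the first component vanishes, `b` moves the second into its place.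
    by_cases hf : f = 0
    · refine ⟨-g, f, ?_, fun hg => hx0 ((mk_eq_zero_iff hp _).2 ⟨hf, neg_eq_zero.1 hg⟩)⟩
      rw [← b_smul_mk]
      exact W.smul_mem _ hx
    · exact ⟨f, g, hx, hf⟩
  have h1 := W.smul_mem (aeval IDInf.aInv (minpoly ℝ c ^ (n + 1))) hfg
  rw [aeval_aInv_smul_mk, AdjoinRoot.mk_self, zero_mul, map_pow] at h1
  -- Climbing by powers of π from this nonzero element reaches the kernel of π, which is generated
  -- by πⁿ; the cofactor is then a unit.
  obtain ⟨k, hk0, hk⟩ := exists_pow_smul_ne_zero (T := π) (n := n + 1)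
    (x := aeval (tInv hp (n + 1)) (minpoly ℝ c) ^ (n + 1) * f)
    (fun h => hf (((hunit.pow (n + 1)).mul_right_eq_zero).1 h)) (by rw [hπn, zero_smul])
  have h2 := W.smul_mem (aeval IDInf.a (minpoly ℝ c ^ k)) h1
  rw [aeval_a_smul_mk, mul_zero, map_pow, ← hπ] at h2
  rw [smul_eq_mul] at hk hk0
  rw [smul_eq_mul] at hk
  obtain ⟨α, hα⟩ := exists_eq_pow_mul hp.irreducible.ne_zero hk
  rw [hα] at h2 hk0
  refine socleGen_mem_of_isUnit_mul hp n (isUnit_of_evalAt_ne_zero fun h => hk0 ?_) h2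
  obtain ⟨α, rfl⟩ := AdjoinRoot.mk_surjective α
  rw [evalAt_mk, ← minpoly.dvd_iff] at h
  obtain ⟨δ, rfl⟩ := h
  rw [map_mul, ← mul_assoc, ← pow_succ, ← hπ, hπn, zero_mul]

end SocleMem

variable {p : ℝ[X]} (hp : IsAdmissiblePoly p) (n : ℕ)

theorem socleGen_mem {W : Submodule IDInf (IDModel p hp (n + 1))} (hW : W ≠ ⊥) :
    socleGen hp n ∈ W := by
  obtain ⟨c, hc0, rfl⟩ := isAdmissiblePoly_iff_minpoly.1 hp
  by_cases hc : ‖c‖ = 1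
  · exact socleGen_mem_of_norm_eq_one hp n hc hW
  · exact socleGen_mem_of_norm_ne_one hp n hc0 hc hW

theorem isIndecomposableModule : IsIndecomposableModule IDInf (IDModel p hp (n + 1)) := by
  refine ⟨⟨_, _, socleGen_ne_zero hp n⟩, fun W₁ W₂ h => ?_⟩
  by_contra! hW
  refine socleGen_ne_zero hp n ?_
  have := h.disjoint.le_bot ⟨socleGen_mem hp n hW.1, socleGen_mem hp n hW.2⟩
  exact this

instance finiteDimensional : FiniteDimensional ℝ (IDModel p hp n) := by
  have := (hp.monic.pow n).finite_adjoinRoot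
  exact inferInstanceAs (FiniteDimensional ℝ (AdjoinRoot (p ^ n) × AdjoinRoot (p ^ n)))

theorem finrank_eq :
    Module.finrank ℝ (IDModel p hp n) = (p ^ n).natDegree + (p ^ n).natDegree := by
  have := (hp.monic.pow n).finite_adjoinRoot
  change Module.finrank ℝ (AdjoinRoot (p ^ n) × AdjoinRoot (p ^ n)) = _
  rw [Module.finrank_prod]
  have h : Module.finrank ℝ (AdjoinRoot (p ^ n)) = (p ^ n).natDegree :=
    finrank_quotient_span_eq_natDegree
  rw [h]

end IDModel

/-! ### Splitting a copy of V(p, n) off a representation -/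

section Splitting

variable {V : Type*} [AddCommGroup V] [Module ℝ V] [Module IDInf V] [IsScalarTower ℝ IDInf V]
  {p : ℝ[X]}

namespace IDModel

variable (hp : IsAdmissiblePoly p) (n : ℕ)

/-- The map `ℝ[t]/(pⁿ) → V`, `f ↦ f(a) v`, well defined if `p(a)ⁿ v = 0`. -/
def orbitMap (v : V) : AdjoinRoot (p ^ n) →ₗ[ℝ] V :=
  (LinearMap.toSpanSingleton IDInf V v).restrictScalars ℝ ∘ₗ
    (aeval IDInf.a : ℝ[X] →ₐ[ℝ] IDInf).toLinearMap ∘ₗ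
      AdjoinRoot.modByMonicHom (hp.monic.pow n)

/-- `orbitMap` is defined for every `v` through the remainder modulo pⁿ; `hv` is what makes any
other representative give the same value. -/
theorem orbitMap_mk {v : V} (hv : aeval IDInf.a (p ^ n) • v = 0) (f : ℝ[X]) :
    orbitMap hp n v (AdjoinRoot.mk _ f) = aeval IDInf.a f • v := by
  change aeval IDInf.a (f %ₘ p ^ n) • v = _
  conv_rhs => rw [← modByMonic_add_div f (p ^ n), mul_comm, map_add, map_mul, add_smul, mul_smul,
    hv, smul_zero, add_zero]

theorem orbitMap_root_mul {v : V} (hv : aeval IDInf.a (p ^ n) • v = 0)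
    (x : AdjoinRoot (p ^ n)) :
    orbitMap hp n v (AdjoinRoot.root (p ^ n) * x) = IDInf.a • orbitMap hp n v x := by
  obtain ⟨f, rfl⟩ := AdjoinRoot.mk_surjective x
  rw [← AdjoinRoot.mk_X, ← map_mul, orbitMap_mk hp n hv, orbitMap_mk hp n hv, map_mul, aeval_X,
    mul_smul]

theorem orbitMap_tInv_mul {v : V} (hv : aeval IDInf.a (p ^ n) • v = 0)
    (x : AdjoinRoot (p ^ n)) :
    orbitMap hp n v (tInv hp n * x) = IDInf.aInv • orbitMap hp n v x := by
  conv_rhs => rw [← one_mul x, ← root_mul_tInv hp n, mul_assoc, orbitMap_root_mul hp n hv,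
    ← mul_smul, IDInf.aInv_mul_a, one_smul]

/-- The real linear map underlying `toRep`. -/
def toRepReal (v : V) : IDModel p hp n →ₗ[ℝ] V :=
  LinearMap.coprod (orbitMap hp n v)
    ((Algebra.lsmul ℝ ℝ V IDInf.b : V →ₗ[ℝ] V) ∘ₗ orbitMap hp n v)

/-- The homomorphism `V(p, n) → V`, `f + b g ↦ f(a) v + b g(a) v`, for `v` killed by `p(a)ⁿ`. -/
def toRep {v : V} (hv : aeval IDInf.a (p ^ n) • v = 0) : IDModel p hp n →ₗ[IDInf] V :=
  IDInf.linearMapOfCommute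
    (toRepReal hp n v)
    (by
      rintro ⟨f, g⟩
      refine (congrArg _ (a_smul_mk p hp n f g)).trans ?_
      change orbitMap hp n v (_ * f) + IDInf.b • orbitMap hp n v (tInv hp n * g) =
        IDInf.a • (orbitMap hp n v f + IDInf.b • orbitMap hp n v g)
      rw [orbitMap_root_mul hp n hv, orbitMap_tInv_mul hp n hv, smul_add, ← mul_smul, ← mul_smul,
        IDInf.b_mul_aInv])
    (by
      rintro ⟨f, g⟩
      refine (congrArg _ (b_smul_mk p hp n f g)).trans ?_
      change orbitMap hp n v (-g) + IDInf.b • orbitMap hp n v f =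
        IDInf.b • (orbitMap hp n v f + IDInf.b • orbitMap hp n v g)
      rw [map_neg, smul_add, ← mul_smul, IDInf.b_mul_b, neg_smul, one_smul, add_comm])

theorem toRep_mk {v : V} (hv : aeval IDInf.a (p ^ n) • v = 0) (f g : AdjoinRoot (p ^ n)) :
    toRep hp n hv (mk p hp n f g) = orbitMap hp n v f + IDInf.b • orbitMap hp n v g := rfl

theorem toRep_socleGen {v : V} (hv : aeval IDInf.a (p ^ (n + 1)) • v = 0) :
    toRep hp (n + 1) hv (socleGen hp n) = aeval IDInf.a (p ^ n) • v := by
  rw [socleGen, toRep_mk, map_zero, smul_zero, add_zero, orbitMap_mk hp _ hv]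

end IDModel

/-- The largest subrepresentation in the kernel of a linear functional. -/
def kerCore (lam : V →ₗ[ℝ] ℝ) : Submodule IDInf V where
  carrier := {x | ∀ y : IDInf, lam (y • x) = 0}
  add_mem' hx hx' y := by rw [smul_add, map_add, hx, hx', add_zero]
  zero_mem' y := by rw [smul_zero, map_zero]
  smul_mem' z x hx y := by rw [← mul_smul]; exact hx _

/-- Division by `q` reduces the test over all polynomials in a to the finitely many powers below deg
q. -/
theorem lam_aeval_smul_eq_zero {q : ℝ[X]} (hq : q.Monic) {lam : V →ₗ[ℝ] ℝ}
    (hlam : ∀ x : V, lam (aeval IDInf.a q • x) = 0) {x : V}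
    (hx : ∀ i < q.natDegree, lam (IDInf.a ^ i • x) = 0) (f : ℝ[X]) :
    lam (aeval IDInf.a f • x) = 0 := by
  rw [← modByMonic_add_div f q, map_add, map_mul, add_smul, mul_smul, map_add, hlam, add_zero]
  by_cases hq1 : q = 1
  · simp [hq1]
  have hdeg := natDegree_modByMonic_lt f hq hq1
  rw [aeval_eq_sum_range, Finset.sum_smul, map_sum]
  refine Finset.sum_eq_zero fun i hi => ?_
  rw [smul_assoc, map_smul, hx i (by rw [Finset.mem_range] at hi; omega), smul_zero]

/-- A functional vanishing on `q(a) V` has a kernel core of codimension at most `2 deg q`, being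
cut out by the functionals `x ↦ λ(aⁱ x)` and `x ↦ λ(aⁱ b x)` for `i < deg q`. -/
theorem mem_kerCore {q : ℝ[X]} (hq : q.Monic) (hcop : IsCoprime X q) {lam : V →ₗ[ℝ] ℝ}
    (hlam : ∀ x : V, lam (aeval IDInf.a q • x) = 0) {x : V}
    (hx : ∀ i < q.natDegree, lam (IDInf.a ^ i • x) = 0)
    (hbx : ∀ i < q.natDegree, lam (IDInf.a ^ i • IDInf.b • x) = 0) : x ∈ kerCore lam := by
  obtain ⟨u, w, huw⟩ := hcop
  -- `L` collects the vectors whose whole ℝ[a]-orbit lies in the kernel of `lam`.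
  let L : Submodule ℝ V :=
    { carrier := {x | ∀ f : ℝ[X], lam (aeval IDInf.a f • x) = 0}
      add_mem' := fun hx hx' f => by rw [smul_add, map_add, hx, hx', add_zero]
      zero_mem' := fun f => by rw [smul_zero, map_zero]
      smul_mem' := fun r x hx f => by rw [smul_comm, map_smul, hx, smul_zero] }
  have hLa : ∀ y ∈ L, IDInf.a • y ∈ L := fun y hy f => by
    have := hy (f * X)
    rwa [map_mul, aeval_X, mul_smul] at this
  have hLaInv : ∀ y ∈ L, IDInf.aInv • y ∈ L := fun y hy f => by
    -- From uX + wq = 1 one gets a⁻¹ = u(a) + q(a) w(a) a⁻¹; `lam` kills the image of q(a), so a⁻¹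
    -- behaves like the polynomial u(a).
    have h1 : aeval IDInf.a f * IDInf.aInv =
        aeval IDInf.a (f * u) + aeval IDInf.a q * (aeval IDInf.a (f * w) * IDInf.aInv) := by
      calc aeval IDInf.a f * IDInf.aInv = aeval IDInf.a (f * (u * X + w * q)) * IDInf.aInv := by
            rw [huw, mul_one]
        _ = aeval IDInf.a (f * u * X + q * (f * w)) * IDInf.aInv := by ring_nf
        _ = _ := by
          rw [map_add, map_mul _ (f * u), map_mul _ q, aeval_X, add_mul, mul_assoc,
            IDInf.a_mul_aInv, mul_one, mul_assoc]
    rw [← mul_smul, h1, add_smul, map_add, hy, mul_smul, hlam, add_zero]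
  -- Requiring both `x` and `b x` to lie in `L` gives stability under `b`, and under `a` because b a
  -- = a⁻¹ b.
  let K : Submodule ℝ V := L ⊓ L.comap (Algebra.lsmul ℝ ℝ V IDInf.b)
  have hxK : x ∈ K :=
    ⟨lam_aeval_smul_eq_zero hq hlam hx, lam_aeval_smul_eq_zero hq hlam hbx⟩
  let K' : Submodule IDInf V := IDInf.submoduleOfStable K
    (fun y hy => ⟨hLa y hy.1, by
      change IDInf.b • IDInf.a • y ∈ L
      rw [← mul_smul, IDInf.b_mul_a, mul_smul]
      exact hLaInv _ hy.2⟩)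
    (fun y hy => ⟨hy.2, by
      change IDInf.b • IDInf.b • y ∈ L
      rw [← mul_smul, IDInf.b_mul_b, neg_smul, one_smul]
      exact L.neg_mem hy.1⟩)
  intro y
  have h := (K'.smul_mem y hxK).1 1
  rwa [map_one, one_smul] at h

theorem IsAdmissiblePoly.isCoprime_X_pow (hp : IsAdmissiblePoly p) (n : ℕ) :
    IsCoprime X (p ^ n) := by
  refine IsCoprime.pow_right ((irreducible_X.coprime_iff_not_dvd).2 ?_)
  rw [X_dvd_iff, coeff_zero_eq_eval_zero]
  exact hp.eval_zero_ne_zero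

/-- The map `V(p, n) → V` attached to `v` is a split injection if `v` has exact order `pⁿ` and
`p(a)ⁿ⁻¹ v` is not in `p(a)ⁿ V`. -/
theorem exists_isCompl_range_toRep (hp : IsAdmissiblePoly p) (n : ℕ) {v : V}
    (hv : aeval IDInf.a (p ^ (n + 1)) • v = 0)
    (hv' : ∀ y : V, aeval IDInf.a (p ^ (n + 1)) • y ≠ aeval IDInf.a (p ^ n) • v) :
    Function.Injective (IDModel.toRep hp (n + 1) hv) ∧
      ∃ K : Submodule IDInf V, IsCompl (LinearMap.range (IDModel.toRep hp (n + 1) hv)) K := by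
  set Φ := IDModel.toRep hp (n + 1) hv with hΦ
  set q := p ^ (n + 1) with hq
  obtain ⟨lam, hlam_ne, hlam⟩ := Submodule.exists_le_ker_of_notMem
    (p := LinearMap.range (Algebra.lsmul ℝ ℝ V (aeval IDInf.a q) : V →ₗ[ℝ] V))
    (v := aeval IDInf.a (p ^ n) • v) (by rintro ⟨y, hy⟩; exact hv' y hy)
  replace hlam : ∀ x : V, lam (aeval IDInf.a q • x) = 0 := fun x => hlam ⟨x, rfl⟩
  -- A nonzero preimage would contain the socle vector, which Φ sends to p(a)ⁿ v, where `lam` does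
  -- not vanish.
  have hcomap : (kerCore lam).comap Φ = ⊥ := by
    by_contra h
    have := IDModel.socleGen_mem hp n h 1
    rw [one_smul, hΦ, IDModel.toRep_socleGen] at this
    exact hlam_ne this
  have hinj : Function.Injective Φ := by
    rw [← LinearMap.ker_eq_bot, ← le_bot_iff, ← hcomap]
    exact fun x hx => by rw [Submodule.mem_comap, LinearMap.mem_ker.1 hx]; exact zero_mem _
  refine ⟨hinj, kerCore lam, ?_⟩
  let coords (T : V →ₗ[ℝ] V) : V →ₗ[ℝ] (Fin q.natDegree → ℝ) :=
    LinearMap.pi fun i => lam ∘ₗ (Algebra.lsmul ℝ ℝ V (IDInf.a ^ (i : ℕ)) : V →ₗ[ℝ] V) ∘ₗ T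
  let Ψ : V →ₗ[ℝ] (Fin q.natDegree → ℝ) × (Fin q.natDegree → ℝ) :=
    (coords LinearMap.id).prod (coords (Algebra.lsmul ℝ ℝ V IDInf.b))
  have hΨ (x : V) (hx : Ψ x = 0) : x ∈ kerCore lam :=
    mem_kerCore (hp.monic.pow _) (hp.isCoprime_X_pow _) hlam
      (fun i hi => congrFun (congrArg Prod.fst hx) ⟨i, hi⟩)
      (fun i hi => congrFun (congrArg Prod.snd hx) ⟨i, hi⟩)
  have hΨΦ : Function.Injective (Ψ ∘ₗ Φ.restrictScalars ℝ) := by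
    rw [← LinearMap.ker_eq_bot, eq_bot_iff]
    intro x hx
    have : x ∈ (kerCore lam).comap Φ := hΨ _ hx
    rwa [hcomap] at this
  -- Both sides have real dimension 2 deg q, so injectivity suffices; thus Ψ restricted to the image
  -- of Φ is already onto, and any `x` can be corrected into the core.
  have hsurj : Function.Surjective (Ψ ∘ₗ Φ.restrictScalars ℝ) := by
    refine (LinearMap.injective_iff_surjective_of_finrank_eq_finrank ?_).1 hΨΦ
    rw [IDModel.finrank_eq, Module.finrank_prod, Module.finrank_fin_fun]
  constructor
  · rw [disjoint_iff_inf_le]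
    rintro _ ⟨⟨x, rfl⟩, hx⟩
    have : x ∈ (kerCore lam).comap Φ := hx
    rw [hcomap, Submodule.mem_bot] at this
    rw [this, map_zero]
    exact zero_mem _
  · rw [codisjoint_iff_le_sup]
    intro x _
    obtain ⟨y, hy⟩ := hsurj (Ψ x)
    rw [Submodule.mem_sup]
    refine ⟨Φ y, ⟨y, rfl⟩, x - Φ y, hΨ _ ?_, add_sub_cancel _ _⟩
    rw [map_sub, sub_eq_zero]
    exact hy.symm

/-- A nonzero finite-dimensional representation has a vector killed by some admissible `p(a)`. -/
theorem exists_admissible_eigenvector [FiniteDimensional ℝ V] [Nontrivial V] :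
    ∃ p : ℝ[X], IsAdmissiblePoly p ∧ ∃ v : V, v ≠ 0 ∧ aeval IDInf.a p • v = 0 := by
  set T : Module.End ℝ V := Algebra.lsmul ℝ ℝ V IDInf.a with hT
  have haeval (f : ℝ[X]) (v : V) : aeval T f v = aeval IDInf.a f • v := by
    rw [hT, aeval_algHom_apply]; rfl
  have hint : IsIntegral ℝ T := Algebra.IsIntegral.isIntegral T
  obtain ⟨c, hc⟩ := IsAlgClosed.exists_aeval_eq_zero ℂ (minpoly ℝ T)
    (minpoly.degree_pos hint).ne'
  have hdvd := minpoly.dvd ℝ c hc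
  -- A non-unit factor of the minimal polynomial has a kernel: by minimality its cofactor is nonzero
  -- at `T`, and any nonzero value of that cofactor is killed.
  have hev {f : ℝ[X]} (hf : f ∣ minpoly ℝ T) (hu : ¬ IsUnit f) :
      ∃ v : V, v ≠ 0 ∧ aeval IDInf.a f • v = 0 := by
    obtain ⟨h, hh⟩ := hf
    have hmin := minpoly.aeval ℝ T
    have hh0 : aeval T h ≠ 0 := by
      intro h0
      have h1 := minpoly.dvd ℝ T h0
      have hne : h ≠ 0 := by rintro rfl; exact minpoly.ne_zero hint (by rw [hh, mul_zero])
      rw [hh] at h1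
      exact hu (isUnit_of_dvd_one ((mul_dvd_mul_iff_right hne).1 (by rwa [one_mul])))
    obtain ⟨w, hw⟩ : ∃ w, aeval T h w ≠ 0 := by
      by_contra! h1
      exact hh0 (LinearMap.ext h1)
    refine ⟨_, hw, ?_⟩
    rw [← haeval, ← Module.End.mul_apply, ← map_mul, ← hh, hmin, LinearMap.zero_apply]
  refine ⟨minpoly ℝ c, isAdmissiblePoly_iff_minpoly.2 ⟨c, ?_, rfl⟩,
    hev hdvd (minpoly.not_isUnit ℝ c)⟩
  -- For c = 0 the factor would be X, giving a nonzero vector killed by the invertible a.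
  rintro rfl
  rw [minpoly.zero] at hdvd
  obtain ⟨v, hv, h0⟩ := hev hdvd not_isUnit_X
  apply hv
  rw [aeval_X] at h0
  rw [← one_smul IDInf v, ← IDInf.aInv_mul_a, mul_smul, h0, smul_zero]

/-- A vector generating a summand of the form `V(p, n + 1)`. -/
theorem exists_order_vector [FiniteDimensional ℝ V] {v₀ : V} (hv₀ : v₀ ≠ 0)
    (h₀ : aeval IDInf.a p • v₀ = 0) :
    ∃ (n : ℕ) (v : V), aeval IDInf.a (p ^ (n + 1)) • v = 0 ∧
      ∀ y : V, aeval IDInf.a (p ^ (n + 1)) • y ≠ aeval IDInf.a (p ^ n) • v := by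
  classical
  set P : IDInf := aeval IDInf.a p with hP
  have hex : ∃ k, ∀ x : V, P ^ (k + 1) • x = 0 → P ^ k • x = 0 := by
    obtain ⟨k, -, hk⟩ := Module.End.exists_ker_pow_eq_ker_pow_succ
      (Algebra.lsmul ℝ ℝ V P : Module.End ℝ V)
    refine ⟨k, fun x hx => ?_⟩
    rw [← map_pow (Algebra.lsmul ℝ ℝ V), ← map_pow (Algebra.lsmul ℝ ℝ V)] at hk
    have : x ∈ LinearMap.ker (Algebra.lsmul ℝ ℝ V (P ^ (k + 1)) : Module.End ℝ V) := hx
    exact (hk ▸ this :)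
  -- The kernels of the powers of P stabilise first at `n + 1`, which is positive because `v₀` lies
  -- in ker P. Some `v` is thus killed by Pⁿ⁺¹ but not by Pⁿ.
  obtain ⟨n, hn⟩ : ∃ n, Nat.find hex = n + 1 := by
    refine Nat.exists_eq_succ_of_ne_zero fun h => hv₀ ?_
    have := Nat.find_spec hex v₀
    rw [h] at this
    simpa [h₀] using this
  have hmin := Nat.find_min hex (m := n) (by omega)
  have hspec := Nat.find_spec hex
  rw [hn] at hspec
  push Not at hmin
  obtain ⟨v, hv, hv'⟩ := hmin
  refine ⟨n, v, by rwa [map_pow], fun y hy => hv' ?_⟩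
  rw [map_pow, map_pow, ← hP] at hy
  rw [← hy]
  -- If Pⁿ⁺¹ y = Pⁿ v, then Pⁿ⁺² y = Pⁿ⁺¹ v = 0, so stabilisation gives Pⁿ⁺¹ y = 0, that is Pⁿ v =
  -- 0.
  refine hspec y ?_
  rw [pow_succ', mul_smul, hy, ← mul_smul, ← pow_succ', hv]

end Splitting

theorem IsIndecomposableModule.of_linearEquiv {R V W : Type*} [Ring R] [AddCommGroup V] [Module R V]
    [AddCommGroup W] [Module R W] (e : V ≃ₗ[R] W) (h : IsIndecomposableModule R W) :
    IsIndecomposableModule R V := by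
  obtain ⟨hn, h⟩ := h
  refine ⟨e.toEquiv.nontrivial, fun W₁ W₂ hW => ?_⟩
  have := h _ _ ((Submodule.orderIsoMapComap e).isCompl_iff.1 hW)
  simpa using this

end

/-! ### The classification -/

theorem theorem1p1 (V : Type*) [AddCommGroup V] [Module ℝ V] [Module IDInf V]
    [IsScalarTower ℝ IDInf V] :
    (FiniteDimensional ℝ V ∧ IsIndecomposableModule IDInf V) ↔
      ∃ (p : ℝ[X]) (hp : IsAdmissiblePoly p) (n : ℕ),
        1 ≤ n ∧ Nonempty (V ≃ₗ[IDInf] IDModel p hp n) := by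
  constructor
  · rintro ⟨hfin, hnt, hV⟩
    obtain ⟨p, hp, v₀, hv₀, h₀⟩ := exists_admissible_eigenvector (V := V)
    obtain ⟨n, v, hv, hv'⟩ := exists_order_vector hv₀ h₀
    obtain ⟨hinj, K, hK⟩ := exists_isCompl_range_toRep hp n hv hv'
    have hsurj : Function.Surjective (IDModel.toRep hp (n + 1) hv) := by
      rw [← LinearMap.range_eq_top]
      rcases hV _ _ hK with h | h
      · refine absurd ?_ (IDModel.socleGen_ne_zero hp n)
        apply hinj
        rw [map_zero]
        exact LinearMap.congr_fun (LinearMap.range_eq_bot.1 h) _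
      · rw [h] at hK
        exact hK.sup_eq_top.symm.trans (sup_bot_eq _) |>.symm
    exact ⟨p, hp, n + 1, by omega, ⟨(LinearEquiv.ofBijective _ ⟨hinj, hsurj⟩).symm⟩⟩
  · rintro ⟨p, hp, n, hn, ⟨e⟩⟩
    obtain ⟨n, rfl⟩ : ∃ m, n = m + 1 := ⟨n - 1, by omega⟩
    exact ⟨(e.restrictScalars ℝ).symm.finiteDimensional,
      (IDModel.isIndecomposableModule hp n).of_linearEquiv e⟩
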